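/- Let $L\ge 1$, $C_0\ge 1$, $C_1\ge 1$ and $d_0>0$ be real numbers. There is a constant $c=c(L,C_0,C_1,d_0)>0$ such that for every $\varepsilon>0$ there is $\delta>0$, depending only on $\varepsilon,L,C_0,C_1,d_0$, with the following property. Let $G$ be a compact group equipped with a compatible bi-invariant metric $d$, and write $|\cdot|$ for its Haar probability measure and $x_\eta$ for the open ball of radius $\eta$ centred at $x\in G$. Suppose that $(G,d)$ is $L$-locally random with coefficient $C_0$, that is, \[ \|\pi(x)-\pi(y)\|_{\mathrm{op}}\le C_0(\dim\pi)^L d(x,y) \] for every irreducible unitary representation $\pi$ of $G$ and all $x,y\in G$, and that $(G,d)$ satisfies the dimension condition $\mathrm{DC}(C_1,d_0)$, that is, \[ \frac1{C_1}\eta^{d_0}\le |1_\eta|\le C_1\eta^{d_0}\qquad\text{for all }\eta\in(0,1). \] For $\eta>0$ and a non-empty set $A\subseteq G$ let $h(A;\eta)=\log\mathcal N_\eta(A)$, where $\mathcal N_\eta(A)$ is the least number of open balls of radius $\eta$ with centres in $A$ required to cover $A$, and let $A_\eta=\bigcup_{x\in A}x_\eta$. Then for all $\eta>0$ and all non-empty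 $A,B\subseteq G$ satisfying \[ \frac{h(A;\eta)+h(B;\eta)}2\ge(1-\delta)\,h(G;\eta)\qquad\text{and}\qquad \eta^{\varepsilon}\le c, \] we have \[ A_\eta B_\eta B_\eta^{-1}A_\eta^{-1}\supseteq 1_{\eta^{\varepsilon}}. \] -/

import Mathlib

open MeasureTheory Metric
open scoped Pointwise

universe u

/-- A unitary representation of a topological group `G` on a complex Hilbert space `H`: a
homomorphism into the unitary group of `H` for which `(g, v) ↦ g • v` is jointly continuous. -/
structure UnitaryRep (G : Type*) [Group G] [TopologicalSpace G] (H : Type*)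
    [NormedAddCommGroup H] [InnerProductSpace ℂ H] [CompleteSpace H] where
  /-- the underlying homomorphism into the group of unitary operators -/
  toHom : G →* unitary (H →L[ℂ] H)
  /-- joint continuity of the action -/
  continuous_action : Continuous fun p : G × H => (toHom p.1 : H →L[ℂ] H) p.2

/-- The operator `π(g)`. -/
noncomputable def UnitaryRep.op {G : Type*} [Group G] [TopologicalSpace G] {H : Type*}
    [NormedAddCommGroup H] [InnerProductSpace ℂ H] [CompleteSpace H]
    (π : UnitaryRep G H) (g : G) : H →L[ℂ] H :=
  (π.toHom g : H →L[ℂ] H)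

/-- A unitary representation is irreducible if its space is nonzero and the only closed invariant
subspaces are `0` and the whole space. -/
def UnitaryRep.IsIrreducible {G : Type*} [Group G] [TopologicalSpace G] {H : Type*}
    [NormedAddCommGroup H] [InnerProductSpace ℂ H] [CompleteSpace H]
    (π : UnitaryRep G H) : Prop :=
  Nontrivial H ∧
    ∀ W : Submodule ℂ H, IsClosed (W : Set H) → (∀ g : G, ∀ v ∈ W, π.op g v ∈ W) →
      W = ⊥ ∨ W = ⊤

/-- `(G, d)` is `L`-locally random with coefficient `C₀`:
`‖π(x) - π(y)‖ ≤ C₀ (dim π)^L d(x, y)` for every irreducible unitary representation `π` and all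
`x, y`. The groups considered are compact, so that the irreducible unitary representations are
finite-dimensional and each of them has an isomorphic copy on a Hilbert space in any given
universe; the inequality depends only on the isomorphism class. -/
def IsLocallyRandom (G : Type u) [Group G] [MetricSpace G] (L C₀ : ℝ) : Prop :=
  ∀ (H : Type u) [NormedAddCommGroup H] [InnerProductSpace ℂ H] [CompleteSpace H]
    [FiniteDimensional ℂ H] (π : UnitaryRep G H), π.IsIrreducible →
    ∀ x y : G, ‖π.op x - π.op y‖ ≤ C₀ * (Module.finrank ℂ H : ℝ) ^ L * dist x y

/-- The dimension condition `DC(C₁, d₀)` for a group with a metric and a measure `μ` (used for the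
Haar probability measure): `C₁⁻¹ η ^ d₀ ≤ |1_η| ≤ C₁ η ^ d₀` for all `0 < η < 1`, where `1_η` is
the open ball of radius `η` centred at the identity. -/
def DimensionCondition {G : Type*} [Group G] [MetricSpace G] [MeasurableSpace G]
    (μ : Measure G) (C₁ d₀ : ℝ) : Prop :=
  ∀ η : ℝ, 0 < η → η < 1 →
    1 / C₁ * η ^ d₀ ≤ μ.real (ball 1 η) ∧ μ.real (ball 1 η) ≤ C₁ * η ^ d₀

/-- The least number of open balls of radius `η` with centres in `A` that cover `A` (such a finite
cover exists for every subset of a compact space, if `η > 0`). -/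
noncomputable def coverNumber {X : Type*} [MetricSpace X] (A : Set X) (η : ℝ) : ℕ :=
  sInf {n : ℕ | ∃ F : Finset X, (F : Set X) ⊆ A ∧ A ⊆ (⋃ x ∈ F, ball x η) ∧ F.card = n}

/-- The metric entropy `h(A; η)`, for nonempty `A`. -/
noncomputable def metricEntropy {X : Type*} [MetricSpace X] (A : Set X) (η : ℝ) : ℝ :=
  Real.log (coverNumber A η)

/-!
Why the theorem holds. Let `f` and `g` be tent functions over the `η`-neighbourhoods of `A` and `B`,
and let `F = f * g`. If the conclusion failed for some `h` with `d(h, 1) < η ^ ε`, then `F` and its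
translate `λ_h F` would have disjoint supports, hence `‖λ_h F - F‖² = 2 ‖F‖²` in `L²(G)`. Quasirandomness
rules this out.

Convolution by `g` is a Hilbert–Schmidt operator `S` on `L²(G)`, of squared norm at most `1`, and
commutes with left translations. So `S† S` is compact and positive and its eigenspaces are invariant
under the left regular representation; this replaces the Peter–Weyl theorem. On an eigenspace of
dimension at most `D`, local randomness (`IsLocallyRandom.norm_op_sub_op_le`, which extends it to
reducible representations) says that `h` moves vectors by at most half their length, if
`C₀ D ^ L η ^ ε = 1 / 2`. An eigenspace of dimension greater than `D` has eigenvalue at most `1 / D`,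
since the trace of `S† S` is at most `1`. Summing over the eigenspaces
(`UnitaryRep.norm_map_op_sub_sq_le`) gives `‖λ_h F - F‖² ≤ ‖F‖² / 4 + (4 / D) ‖f‖²`, with `‖f‖ ≤ 1`.

It remains to see that `‖F‖²`, which is at least `(∫ f ∫ g)²`, exceeds `4 / D`
(`exists_mul_mul_eq_mul_of_ne_zero`). By packing, `∫ f` is at least a constant times `η ^ d₀` times the
covering number of `A`, and similarly for `g`, so the entropy hypothesis bounds `∫ f ∫ g` below by a
constant times `η ^ (2 δ d₀)`; while `4 / D` is a constant times `η ^ (ε / L)`. For `δ` small in terms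
of `ε / (d₀ L)` the latter is smaller as soon as `η ^ ε` is below a constant.
-/

/-! ### Unitary representations -/

section UnitaryRep

variable {G : Type*} [Group G] [TopologicalSpace G] {H : Type*}
  [NormedAddCommGroup H] [InnerProductSpace ℂ H] [CompleteSpace H]

namespace UnitaryRep

/-- The unitary representation given by a multiplicative family of norm-preserving operators. -/
noncomputable def ofNormMap (A : G → H →L[ℂ] H) (h_one : A 1 = 1)
    (h_mul : ∀ g h, A (g * h) = A g * A h) (h_norm : ∀ g v, ‖A g v‖ = ‖v‖)
    (h_cont : Continuous fun p : G × H => A p.1 p.2) : UnitaryRep G H where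
  toHom := MonoidHom.mk' (fun g => ⟨A g, by
    have h_inv : ∀ g, A g * A g⁻¹ = 1 := fun g => by rw [← h_mul, mul_inv_cancel, h_one]
    have h_inv' : ∀ g, A g⁻¹ * A g = 1 := fun g => by rw [← h_mul, inv_mul_cancel, h_one]
    have h_inner : ∀ v w, inner ℂ (A g v) (A g w) = inner ℂ v w :=
      (LinearMap.norm_map_iff_inner_map_map (A g)).1 (h_norm g)
    have h_star : star (A g) = A g⁻¹ := by
      rw [ContinuousLinearMap.star_eq_adjoint, eq_comm, ContinuousLinearMap.eq_adjoint_iff]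
      intro v w
      rw [← h_inner, ← mul_apply_eq_comp, h_inv, one_apply_eq_self]
    rw [Unitary.mem_iff, h_star]
    exact ⟨h_inv' g, h_inv g⟩⟩) fun g h => Subtype.ext (h_mul g h)
  continuous_action := h_cont

variable (π : UnitaryRep G H)

@[simp]
lemma op_one : π.op 1 = 1 := by simp [op]

lemma op_mul (g h : G) : π.op (g * h) = π.op g * π.op h := by simp [op]

@[simp]
lemma op_inv_op (g : G) (v : H) : π.op g⁻¹ (π.op g v) = v := by
  rw [← mul_apply_eq_comp, ← op_mul, inv_mul_cancel, op_one,
    one_apply_eq_self]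

lemma inner_op_op (g : G) (v w : H) : inner ℂ (π.op g v) (π.op g w) = inner ℂ v w := by
  have h := (Unitary.mem_iff.1 (π.toHom g).2).1
  rw [← ContinuousLinearMap.adjoint_inner_left, ← ContinuousLinearMap.star_eq_adjoint,
    ← mul_apply_eq_comp]
  exact congrArg (fun T : H →L[ℂ] H => inner ℂ (T v) w) h

@[simp]
lemma norm_op (g : G) (v : H) : ‖π.op g v‖ = ‖v‖ :=
  (LinearMap.norm_map_iff_inner_map_map (π.op g)).2 (π.inner_op_op g) v

/-- The restriction of a unitary representation to a complete invariant subspace. -/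
noncomputable def restrict (W : Submodule ℂ H) [CompleteSpace W]
    (hW : ∀ g, ∀ v ∈ W, π.op g v ∈ W) : UnitaryRep G W :=
  ofNormMap (fun g => ((π.op g).comp W.subtypeL).codRestrict W fun v => hW g v v.2)
    (by ext; simp) (fun g h => by ext v; exact congrArg (· (v : H)) (π.op_mul g h))
    (fun g v => π.norm_op g v)
    (Continuous.subtype_mk
      (π.continuous_action.comp (continuous_fst.prodMk (continuous_subtype_val.comp continuous_snd)))
      _)

lemma op_mem_orthogonal {W : Submodule ℂ H} (hW : ∀ g, ∀ v ∈ W, π.op g v ∈ W) (g : G) {v : H}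
    (hv : v ∈ Wᗮ) : π.op g v ∈ Wᗮ := fun w hw => by
  rw [← π.inner_op_op g⁻¹, op_inv_op]
  exact hv _ (hW _ _ hw)

end UnitaryRep

end UnitaryRep

/-- In a locally random group the defining inequality holds for all finite-dimensional unitary
representations: it passes to orthogonal direct sums because `n ↦ n ^ L` is monotone. -/
theorem IsLocallyRandom.norm_op_sub_op_le {G : Type u} [Group G] [MetricSpace G] {L C₀ : ℝ}
    (hG : IsLocallyRandom G L C₀) (hL : 0 ≤ L) (hC₀ : 0 ≤ C₀) (x y : G)
    {H : Type u} [NormedAddCommGroup H] [InnerProductSpace ℂ H] [CompleteSpace H]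
    [FiniteDimensional ℂ H] (π : UnitaryRep G H) (v : H) :
    ‖π.op x v - π.op y v‖ ≤ C₀ * (Module.finrank ℂ H : ℝ) ^ L * dist x y * ‖v‖ := by
  induction hn : Module.finrank ℂ H using Nat.strong_induction_on generalizing H with
  | _ n ih =>
  subst hn
  by_cases hirr : π.IsIrreducible
  · rw [← sub_apply]
    exact ((π.op x - π.op y).le_opNorm v).trans
      (mul_le_mul_of_nonneg_right (hG H π hirr x y) (norm_nonneg v))
  rcases subsingleton_or_nontrivial H with hH | hH
  · simp [Subsingleton.elim v 0]
  simp only [UnitaryRep.IsIrreducible, hH, true_and, not_forall, not_or] at hirr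
  obtain ⟨W, -, hW, hbot, htop⟩ := hirr
  have hW' : ∀ g, ∀ v ∈ Wᗮ, π.op g v ∈ Wᗮ := fun g v hv => π.op_mem_orthogonal hW g hv
  have key : ∀ V : Submodule ℂ H, V ≠ ⊤ → (∀ g, ∀ v ∈ V, π.op g v ∈ V) → ∀ v ∈ V,
      ‖π.op x v - π.op y v‖ ≤ C₀ * (Module.finrank ℂ H : ℝ) ^ L * dist x y * ‖v‖ := by
    intro V hV hinv v hv
    have hlt := Submodule.finrank_lt hV
    refine (ih _ hlt (π.restrict V hinv) ⟨v, hv⟩ rfl).trans ?_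
    simp only [Submodule.coe_norm]
    gcongr
  -- `W` and its orthogonal complement are both proper and invariant, so the induction applies to them.
  obtain ⟨w, hw, w', hw', rfl⟩ := W.exists_add_mem_mem_orthogonal v
  have h₁ := key W htop hW w hw
  have h₂ := key Wᗮ (by rwa [Ne, Submodule.orthogonal_eq_top_iff]) hW' w' hw'
  set M := C₀ * (Module.finrank ℂ H : ℝ) ^ L * dist x y with hM
  have hM0 : 0 ≤ M := by positivity
  have hpyth : ∀ {a b : H}, a ∈ W → b ∈ Wᗮ → ‖a + b‖ * ‖a + b‖ = ‖a‖ * ‖a‖ + ‖b‖ * ‖b‖ :=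
    fun ha hb => norm_add_sq_eq_norm_sq_add_norm_sq_of_inner_eq_zero _ _ (hb _ ha)
  have e : π.op x (w + w') - π.op y (w + w') =
      (π.op x w - π.op y w) + (π.op x w' - π.op y w') := by
    simp only [map_add]; abel
  rw [e]
  refine le_of_sq_le_sq ?_ (by positivity)
  rw [mul_pow, sq, sq ‖w + w'‖, hpyth (W.sub_mem (hW _ _ hw) (hW _ _ hw))
    (Wᗮ.sub_mem (hW' _ _ hw') (hW' _ _ hw')), hpyth hw hw']
  nlinarith [mul_self_le_mul_self (norm_nonneg _) h₁, mul_self_le_mul_self (norm_nonneg _) h₂]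

/-! ### Compact operators with an invariant Gram form -/

open Module.End in
/-- **Displacement bound.** Let `S` be a compact operator whose Gram form `⟪S v, S w⟫` is invariant
under a unitary representation `π`, and whose squared Hilbert–Schmidt norm is at most `K`. If `g`
moves the vectors of every invariant subspace of dimension at most `D` by at most the factor `a`,
then `g` moves `S v` little: each eigenspace of `S† S` is invariant, and one of dimension
exceeding `D` has eigenvalue at most `K / D`. -/
theorem UnitaryRep.norm_map_op_sub_sq_le {G : Type*} [Group G] [TopologicalSpace G]
    {E F : Type*} [NormedAddCommGroup E] [InnerProductSpace ℂ E] [CompleteSpace E]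
    [NormedAddCommGroup F] [InnerProductSpace ℂ F] [CompleteSpace F]
    (π : UnitaryRep G E) (S : E →L[ℂ] F) (hS : IsCompactOperator S)
    (hinv : ∀ g v w, inner ℂ (S (π.op g v)) (S (π.op g w)) = inner ℂ (S v) (S w))
    {K : ℝ} (hK : ∀ (n : ℕ) (e : Fin n → E), Orthonormal ℂ e → ∑ i, ‖S (e i)‖ ^ 2 ≤ K)
    {D a : ℝ} (hD : 0 < D) (g : G)
    (hsmall : ∀ W : Submodule ℂ E, FiniteDimensional ℂ W → (∀ h, ∀ v ∈ W, π.op h v ∈ W) →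
      (Module.finrank ℂ W : ℝ) ≤ D → ∀ v ∈ W, ‖π.op g v - v‖ ≤ a * ‖v‖) (v : E) :
    ‖S (π.op g v - v)‖ ^ 2 ≤ a ^ 2 * ‖S v‖ ^ 2 + 4 * K / D * ‖v‖ ^ 2 := by
  have hK0 : 0 ≤ K := by simpa using hK 0 Fin.elim0 (by simp [Orthonormal])
  set T : E →L[ℂ] E := (ContinuousLinearMap.adjoint S).comp S with hT
  have hTS : ∀ v w, inner ℂ v (T w) = inner ℂ (S v) (S w) := fun v w => by
    rw [hT, ContinuousLinearMap.comp_apply, ContinuousLinearMap.adjoint_inner_right]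
  have hTS' : ∀ v w, inner ℂ (T v) w = inner ℂ (S v) (S w) := fun v w => by
    rw [hT, ContinuousLinearMap.comp_apply, ContinuousLinearMap.adjoint_inner_left]
  have hsymm : T.IsSymmetric := fun v w => (hTS' v w).trans (hTS v w).symm
  have hcomp : IsCompactOperator T := hS.clm_comp (ContinuousLinearMap.adjoint S)
  have hcomm : ∀ g v, T (π.op g v) = π.op g (T v) := fun g v => by
    refine ext_inner_left ℂ fun w => ?_
    have hw : π.op g (π.op g⁻¹ w) = w := by simpa using π.op_inv_op g⁻¹ w
    rw [hTS, ← hw, hinv, π.inner_op_op, hTS]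
  let V : ℂ → Submodule ℂ E := fun μ => eigenspace (T : Module.End ℂ E) μ
  have hVT : ∀ {μ v}, v ∈ V μ → T v = μ • v := fun hv => mem_eigenspace_iff.1 hv
  have hVinv : ∀ μ g, ∀ v ∈ V μ, π.op g v ∈ V μ := fun μ g v hv => by
    refine mem_eigenspace_iff.2 ?_
    change T _ = _
    rw [hcomm, hVT hv, map_smul]
  have horth : OrthogonalFamily ℂ (fun μ => V μ) fun μ => (V μ).subtypeₗᵢ :=
    hsymm.orthogonalFamily_eigenspaces
  have hself : ∀ v, (inner ℂ (S v) (S v)).re = ‖S v‖ ^ 2 := fun v =>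
    inner_self_eq_norm_sq (𝕜 := ℂ) (S v)
  have hre : ∀ (μ : ℂ) (v : E), (inner ℂ v (μ • v)).re = μ.re * ‖v‖ ^ 2 := fun μ v => by
    rw [inner_smul_right, Complex.mul_re, ← inner_self_eq_norm_sq (𝕜 := ℂ) v,
      show (inner ℂ v v).im = 0 from inner_self_im (𝕜 := ℂ) v, mul_zero, sub_zero]
    rfl
  have hnorm : ∀ {μ v}, v ∈ V μ → ‖S v‖ ^ 2 = μ.re * ‖v‖ ^ 2 := fun {μ v} hv => by
    rw [← hself, ← hTS, hVT hv, hre]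
  -- Distinct eigenspaces of `S† S` have orthogonal images under `S`.
  have hsum : ∀ (s : Finset ℂ) (x : ∀ μ, V μ),
      ‖S (∑ μ ∈ s, (x μ : E))‖ ^ 2 = ∑ μ ∈ s, ‖S (x μ)‖ ^ 2 := fun s x => by
    have h : inner ℂ (∑ μ ∈ s, (x μ : E)) (∑ μ ∈ s, ((μ • x μ : V μ) : E)) =
      ∑ μ ∈ s, inner ℂ (x μ : E) (μ • (x μ : E)) := horth.inner_sum x (fun μ => μ • x μ) s
    rw [← hself, ← hTS, map_sum T, Finset.sum_congr rfl fun μ _ => (hVT (x μ).2).trans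
      (Submodule.coe_smul μ (x μ)).symm, h, Complex.re_sum]
    exact Finset.sum_congr rfl fun μ _ => by rw [hre, hnorm (x μ).2]
  have hpiece : ∀ μ, ∀ v ∈ V μ,
      ‖S (π.op g v - v)‖ ^ 2 ≤ a ^ 2 * ‖S v‖ ^ 2 + 4 * K / D * ‖v‖ ^ 2 := fun μ v hv => by
    have hmem : π.op g v - v ∈ V μ := (V μ).sub_mem (hVinv μ g v hv) hv
    rw [hnorm hmem, hnorm hv]
    rcases le_or_gt μ.re 0 with hμ | hμ
    · have h0 : μ.re * ‖v‖ ^ 2 = 0 := le_antisymm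
        (mul_nonpos_of_nonpos_of_nonneg hμ (by positivity)) (hnorm hv ▸ by positivity)
      rw [h0]
      have : μ.re * ‖π.op g v - v‖ ^ 2 ≤ 0 := mul_nonpos_of_nonpos_of_nonneg hμ (by positivity)
      exact this.trans (by positivity)
    have hμ0 : μ ≠ 0 := fun h => by simp [h] at hμ
    have hfin : FiniteDimensional ℂ (V μ) :=
      ContinuousLinearMap.finite_dimensional_eigenspace hcomp μ hμ0
    rcases le_or_gt (Module.finrank ℂ (V μ) : ℝ) D with hd | hd
    · have h1 := hsmall (V μ) hfin (hVinv μ) hd v hv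
      have h2 : ‖π.op g v - v‖ ^ 2 ≤ (a * ‖v‖) ^ 2 := pow_le_pow_left₀ (norm_nonneg _) h1 2
      have h3 : 0 ≤ 4 * K / D * ‖v‖ ^ 2 := by positivity
      nlinarith [mul_le_mul_of_nonneg_left h2 hμ.le]
    · have htr := hK _ (fun i => ((stdOrthonormalBasis ℂ (V μ) i : V μ) : E))
        ((stdOrthonormalBasis ℂ (V μ)).orthonormal.comp_linearIsometry (V μ).subtypeₗᵢ)
      have hone : ∀ i, ‖((stdOrthonormalBasis ℂ (V μ) i : V μ) : E)‖ = 1 := fun i =>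
        (stdOrthonormalBasis ℂ (V μ)).orthonormal.1 i
      simp only [hnorm (stdOrthonormalBasis ℂ (V μ) _).2, hone, one_pow, mul_one,
        Finset.sum_const, Finset.card_univ, Fintype.card_fin, nsmul_eq_mul] at htr
      have hle : μ.re ≤ K / D := by
        rw [le_div_iff₀ hD]
        nlinarith
      have h2 : ‖π.op g v - v‖ ^ 2 ≤ (2 * ‖v‖) ^ 2 := by
        refine pow_le_pow_left₀ (norm_nonneg _) ((norm_sub_le _ _).trans ?_) 2
        rw [π.norm_op]; linarith
      have h3 : 0 ≤ a ^ 2 * (μ.re * ‖v‖ ^ 2) := by positivity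
      calc μ.re * ‖π.op g v - v‖ ^ 2 ≤ K / D * (2 * ‖v‖) ^ 2 := by gcongr
        _ = 4 * K / D * ‖v‖ ^ 2 := by ring
        _ ≤ _ := by linarith
  have hdense : Dense ((⨆ μ, V μ : Submodule ℂ E) : Set E) := by
    rw [Submodule.dense_iff_topologicalClosure_eq_top, Submodule.topologicalClosure_eq_top_iff]
    exact ContinuousLinearMap.orthogonalComplement_iSup_eigenspaces_eq_bot hcomp hsymm
  refine hdense.induction (P := fun v => ‖S (π.op g v - v)‖ ^ 2 ≤
    a ^ 2 * ‖S v‖ ^ 2 + 4 * K / D * ‖v‖ ^ 2) (fun v hv => ?_)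
    (isClosed_le (by fun_prop) (by fun_prop)) v
  classical
  obtain ⟨x, rfl⟩ := (Submodule.mem_iSup_iff_exists_dfinsupp' V v).1 hv
  simp only [DFinsupp.sum]
  have hx := hsum x.support fun μ => x μ
  have hy := hsum x.support fun μ => ⟨π.op g (x μ) - x μ,
    (V μ).sub_mem (hVinv μ g _ (x μ).2) (x μ).2⟩
  have hn : ‖∑ μ ∈ x.support, (x μ : E)‖ ^ 2 = ∑ μ ∈ x.support, ‖(x μ : E)‖ ^ 2 :=
    horth.norm_sum (fun μ => x μ) x.support
  simp only [Finset.sum_sub_distrib] at hy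
  rw [map_sum (π.op g), hy, hx, hn, Finset.mul_sum, Finset.mul_sum, ← Finset.sum_add_distrib]
  exact Finset.sum_le_sum fun μ _ => hpiece μ _ (x μ).2

/-! ### Operators given by continuous families of vectors -/

section CoefficientOperator

open scoped BoundedContinuousFunction

lemma BoundedContinuousFunction.norm_toLp_sq {X : Type*} [TopologicalSpace X] [MeasurableSpace X]
    [BorelSpace X] (μ : Measure X) [IsFiniteMeasure μ] (f : X →ᵇ ℂ) :
    ‖BoundedContinuousFunction.toLp 2 μ ℂ f‖ ^ 2 = ∫ x, ‖f x‖ ^ 2 ∂μ := by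
  have h := BoundedContinuousFunction.inner_toLp (𝕜 := ℂ) μ f f
  rw [inner_self_eq_norm_sq_to_K] at h
  simp only [RCLike.mul_conj] at h
  have h2 : ∫ x, ((‖f x‖ : ℂ)) ^ 2 ∂μ = ((∫ x, ‖f x‖ ^ 2 ∂μ : ℝ) : ℂ) := by
    rw [← integral_complex_ofReal]; simp
  exact Complex.ofReal_injective (by rw [← h2]; push_cast; exact h)

variable {X : Type*} [TopologicalSpace X] [CompactSpace X] {E : Type*} [NormedAddCommGroup E]
  [InnerProductSpace ℂ E]

/-- The operator sending `v` to the function `x ↦ ⟪k x, v⟫` attached to a continuous family `k` of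
vectors. -/
noncomputable def coefficientMap (k : C(X, E)) : E →L[ℂ] (X →ᵇ ℂ) :=
  LinearMap.mkContinuous
    { toFun := fun v => BoundedContinuousFunction.mkOfCompact ⟨fun x => inner ℂ (k x) v, by fun_prop⟩
      map_add' := fun v w => by ext x; simp
      map_smul' := fun c v => by ext x; simp }
    ‖k‖ fun v => (BoundedContinuousFunction.norm_le (by positivity)).2 fun x =>
      (norm_inner_le_norm _ _).trans (by gcongr; exact k.norm_coe_le_norm x)

@[simp]
lemma coefficientMap_apply (k : C(X, E)) (v : E) (x : X) :
    coefficientMap k v x = inner ℂ (k x) v := rfl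

/-- Compactness is Arzelà–Ascoli: the modulus of continuity of `k` controls that of `x ↦ ⟪k x, v⟫`
uniformly for `v` in the unit ball. -/
theorem isCompactOperator_coefficientMap (k : C(X, E)) :
    IsCompactOperator (coefficientMap k) := by
  rw [isCompactOperator_iff_exists_mem_nhds_isCompact_closure_image]
  refine ⟨ball 0 1, ball_mem_nhds 0 one_pos, BoundedContinuousFunction.arzela_ascoli
    (closedBall 0 ‖k‖) (isCompact_closedBall _ _) _ ?_ ?_⟩
  · rintro _ x ⟨v, hv, rfl⟩
    rw [mem_ball_zero_iff] at hv
    rw [mem_closedBall_zero_iff, coefficientMap_apply]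
    calc ‖inner ℂ (k x) v‖ ≤ ‖k x‖ * ‖v‖ := norm_inner_le_norm _ _
      _ ≤ ‖k‖ * 1 := by gcongr; exact k.norm_coe_le_norm x
      _ = ‖k‖ := mul_one _
  · intro x
    rw [Metric.equicontinuousAt_iff_right]
    intro ε hε
    filter_upwards [(k.continuous.tendsto x).eventually (ball_mem_nhds (k x) hε)] with y hy
    rintro ⟨_, v, hv, rfl⟩
    rw [mem_ball_zero_iff] at hv
    rw [dist_comm, dist_eq_norm] at hy
    simp only [coefficientMap_apply]
    rw [dist_eq_norm, ← inner_sub_left]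
    calc ‖inner ℂ (k x - k y) v‖ ≤ ‖k x - k y‖ * ‖v‖ := norm_inner_le_norm _ _
      _ ≤ ‖k x - k y‖ * 1 := by gcongr
      _ < ε := by rwa [mul_one]

variable [MeasurableSpace X] [BorelSpace X] (μ : Measure X)

/-- The squared Hilbert–Schmidt norm of the coefficient operator into `L²` is `∫ ‖k x‖²`, by
Bessel's inequality applied at each point. -/
theorem sum_norm_sq_toLp_coefficientMap_le [IsProbabilityMeasure μ] (k : C(X, E)) {K : ℝ}
    (hk : ∀ x, ‖k x‖ ^ 2 ≤ K) {ι : Type*} [Fintype ι] {e : ι → E} (he : Orthonormal ℂ e) :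
    ∑ i, ‖BoundedContinuousFunction.toLp 2 μ ℂ (coefficientMap k (e i))‖ ^ 2 ≤ K := by
  simp only [BoundedContinuousFunction.norm_toLp_sq, coefficientMap_apply]
  have hint : ∀ i, Integrable (fun x => ‖inner ℂ (k x) (e i)‖ ^ 2) μ := fun i =>
    (by fun_prop : Continuous _).integrable_of_hasCompactSupport (.of_compactSpace _)
  rw [← integral_finsetSum _ fun i _ => hint i]
  calc ∫ x, ∑ i, ‖inner ℂ (k x) (e i)‖ ^ 2 ∂μ ≤ ∫ _, K ∂μ :=
        integral_mono (integrable_finsetSum _ fun i _ => hint i) (integrable_const K) fun x => by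
          simp only [norm_inner_symm (k x)]
          exact (he.sum_inner_products_le (k x)).trans (hk x)
    _ = K := by simp

end CoefficientOperator

/-! ### The regular representation -/

section RegularRepresentation

variable {G : Type*} [Group G] [TopologicalSpace G] [IsTopologicalGroup G]
  [MeasurableSpace G] [BorelSpace G] (μ : Measure G) [IsLocallyFiniteMeasure μ]
  [μ.InnerRegularCompactLTTop] [μ.IsMulLeftInvariant]

/-- The left regular representation of `G` on `L²(G)`, `(g • f) x = f (g⁻¹ x)`. -/
noncomputable def leftRegularRep : UnitaryRep G (Lp ℂ 2 μ) :=
  .ofNormMap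
    (fun g => LinearMap.mkContinuous
      { toFun := fun f => DomMulAct.mk g⁻¹ • f
        map_add' := smul_add _
        map_smul' := fun c f => smul_comm (DomMulAct.mk g⁻¹) c f } 1
      fun f => by simp [DomMulAct.norm_smul_Lp])
    (by ext1 f; simp) (fun g h => by ext1 f; simp [mul_smul, mul_inv_rev])
    (fun g f => DomMulAct.norm_smul_Lp _ f)
    (by
      have : Fact ((2 : ENNReal) ≠ ⊤) := ⟨ENNReal.ofNat_ne_top⟩
      change Continuous fun p : G × Lp ℂ 2 μ => DomMulAct.mk p.1⁻¹ • p.2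
      exact (DomMulAct.continuous_mk.comp continuous_fst.inv).smul continuous_snd)

lemma leftRegularRep_op_ae_eq (g : G) (f : Lp ℂ 2 μ) :
    (leftRegularRep μ).op g f =ᵐ[μ] fun x => f (g⁻¹ * x) :=
  DomMulAct.smul_Lp_ae_eq _ _

end RegularRepresentation

/-! ### Convolution operators -/

section Convolution

variable {G : Type*} [TopologicalSpace G] [CompactSpace G] [MeasurableSpace G] [BorelSpace G]
  (μ : Measure G) [IsProbabilityMeasure μ]

/-- The class in `L²(G)` of a continuous real function. -/
noncomputable def realToL2 : C(G, ℝ) → Lp ℂ 2 μ := fun f =>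
  ContinuousMap.toLp 2 μ ℂ ((ContinuousMap.mk ((↑) : ℝ → ℂ) Complex.continuous_ofReal).comp f)

lemma inner_realToL2 (f g : C(G, ℝ)) :
    inner ℂ (realToL2 μ f) (realToL2 μ g) = ((∫ x, f x * g x ∂μ : ℝ) : ℂ) := by
  rw [realToL2, realToL2, ContinuousMap.inner_toLp, ← integral_complex_ofReal]
  refine integral_congr_ae (.of_forall fun x => ?_)
  simp [mul_comm]

lemma norm_realToL2_sq_le_one {f : C(G, ℝ)} (hf : ∀ x, f x ∈ Set.Icc (0 : ℝ) 1) :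
    ‖realToL2 μ f‖ ^ 2 ≤ 1 := by
  rw [← inner_self_eq_norm_sq (𝕜 := ℂ), inner_realToL2]
  change ∫ x, f x * f x ∂μ ≤ 1
  calc ∫ x, f x * f x ∂μ ≤ ∫ _, 1 ∂μ :=
        integral_mono ((by fun_prop : Continuous _).integrable_of_hasCompactSupport
          (.of_compactSpace _)) (integrable_const 1) fun x =>
            mul_le_one₀ (hf x).2 (hf x).1 (hf x).2
    _ = 1 := by simp

variable [Group G] [IsTopologicalGroup G]

/-- The family `x ↦ (y ↦ g (y⁻¹ x))` of vectors of `L²(G)`; its coefficients are the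
convolutions `v * g`. -/
noncomputable def convolutionKernel (g : C(G, ℝ)) : C(G, Lp ℂ 2 μ) :=
  ⟨fun x => realToL2 μ ⟨fun y => g (y⁻¹ * x), by fun_prop⟩, by
    refine (ContinuousMap.toLp (E := ℂ) 2 μ ℂ).continuous.comp
      (ContinuousMap.curry ⟨fun p : G × G => ((g (p.2⁻¹ * p.1) : ℝ) : ℂ), by fun_prop⟩).continuous⟩

lemma convolutionKernel_apply (g : C(G, ℝ)) (x : G) :
    convolutionKernel μ g x = realToL2 μ ⟨fun y => g (y⁻¹ * x), by fun_prop⟩ := rfl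

/-- Convolution by `g` on the right, as an operator on `L²(G)`. -/
noncomputable def convolutionOp (g : C(G, ℝ)) : Lp ℂ 2 μ →L[ℂ] Lp ℂ 2 μ :=
  (BoundedContinuousFunction.toLp 2 μ ℂ).comp (coefficientMap (convolutionKernel μ g))

/-- The convolution `f * g`, as a continuous function. -/
noncomputable def continuousConvolution (f g : C(G, ℝ)) : C(G, ℝ) :=
  ⟨fun x => (coefficientMap (convolutionKernel μ g) (realToL2 μ f) x).re, by fun_prop⟩

lemma coefficientMap_convolutionKernel (f g : C(G, ℝ)) (x : G) :
    coefficientMap (convolutionKernel μ g) (realToL2 μ f) x =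
      ((∫ y, f y * g (y⁻¹ * x) ∂μ : ℝ) : ℂ) := by
  rw [coefficientMap_apply, convolutionKernel_apply, inner_realToL2]
  simp [mul_comm]

lemma continuousConvolution_apply (f g : C(G, ℝ)) (x : G) :
    continuousConvolution μ f g x = ∫ y, f y * g (y⁻¹ * x) ∂μ := by
  change (coefficientMap (convolutionKernel μ g) (realToL2 μ f) x).re = _
  rw [coefficientMap_convolutionKernel, Complex.ofReal_re]

lemma convolutionOp_realToL2 (f g : C(G, ℝ)) :
    convolutionOp μ g (realToL2 μ f) = realToL2 μ (continuousConvolution μ f g) := by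
  have h : coefficientMap (convolutionKernel μ g) (realToL2 μ f) =
      BoundedContinuousFunction.mkOfCompact
        ((ContinuousMap.mk ((↑) : ℝ → ℂ) Complex.continuous_ofReal).comp
          (continuousConvolution μ f g)) := by
    ext x
    simp [coefficientMap_convolutionKernel, continuousConvolution_apply, -coefficientMap_apply]
  rw [convolutionOp, ContinuousLinearMap.comp_apply, h]
  rfl

variable [μ.InnerRegularCompactLTTop] [μ.IsMulLeftInvariant]

lemma leftRegularRep_op_convolutionKernel (g : C(G, ℝ)) (h x : G) :
    (leftRegularRep μ).op h (convolutionKernel μ g x) = convolutionKernel μ g (h * x) := by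
  refine Lp.ext ((leftRegularRep_op_ae_eq μ h _).trans ?_)
  have h1 := ContinuousMap.coeFn_toLp (p := 2) (𝕜 := ℂ) μ
    ((ContinuousMap.mk ((↑) : ℝ → ℂ) Complex.continuous_ofReal).comp
      ⟨fun y => g (y⁻¹ * x), by fun_prop⟩)
  have h2 := ContinuousMap.coeFn_toLp (p := 2) (𝕜 := ℂ) μ
    ((ContinuousMap.mk ((↑) : ℝ → ℂ) Complex.continuous_ofReal).comp
      ⟨fun y => g (y⁻¹ * (h * x)), by fun_prop⟩)
  filter_upwards [(measurePreserving_smul h⁻¹ μ).quasiMeasurePreserving.ae h1, h2] with y hy hy2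
  refine hy.trans (Eq.trans ?_ hy2.symm)
  simp [mul_assoc]

lemma coefficientMap_leftRegularRep_op (g : C(G, ℝ)) (h : G) (v : Lp ℂ 2 μ) (x : G) :
    coefficientMap (convolutionKernel μ g) ((leftRegularRep μ).op h v) x =
      coefficientMap (convolutionKernel μ g) v (h⁻¹ * x) := by
  rw [coefficientMap_apply, coefficientMap_apply, ← (leftRegularRep μ).inner_op_op h⁻¹,
    UnitaryRep.op_inv_op, leftRegularRep_op_convolutionKernel]

lemma inner_convolutionOp_op_op (g : C(G, ℝ)) (h : G) (v w : Lp ℂ 2 μ) :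
    inner ℂ (convolutionOp μ g ((leftRegularRep μ).op h v))
      (convolutionOp μ g ((leftRegularRep μ).op h w)) =
    inner ℂ (convolutionOp μ g v) (convolutionOp μ g w) := by
  simp only [convolutionOp, ContinuousLinearMap.comp_apply, BoundedContinuousFunction.inner_toLp,
    coefficientMap_leftRegularRep_op]
  exact integral_mul_left_eq_self (μ := μ) (fun x => coefficientMap (convolutionKernel μ g) w x *
    (starRingEnd ℂ) (coefficientMap (convolutionKernel μ g) v x)) h⁻¹

lemma integral_continuousConvolution (f g : C(G, ℝ)) :
    ∫ x, continuousConvolution μ f g x ∂μ = (∫ x, f x ∂μ) * ∫ x, g x ∂μ := by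
  simp only [continuousConvolution_apply]
  rw [integral_integral_swap_of_hasCompactSupport (by fun_prop) (.of_compactSpace _)]
  simp only [integral_const_mul, integral_mul_left_eq_self (μ := μ) (fun x => g x),
    integral_mul_const]

/-- If `h` moves the vectors of the invariant subspaces of `L²(G)` of dimension at most `D` by at
most half their length, and `f * g` has mass large compared with `D ^ (-1 / 2)`, then `f * g` and its
translate by `h` are not orthogonal, so that `h` lies in `A B B⁻¹ A⁻¹` for the supports `A` of `f` and
`B` of `g`. Orthogonality would make the squared norm of the difference equal to twice that of `f * g`,
against the displacement bound for convolution by `g`. -/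
theorem exists_mul_mul_eq_mul_of_ne_zero {f g : C(G, ℝ)} (hf : ∀ x, f x ∈ Set.Icc (0 : ℝ) 1)
    (hg : ∀ x, g x ∈ Set.Icc (0 : ℝ) 1) {D : ℝ} (hD : 0 < D) (h : G)
    (hsmall : ∀ W : Submodule ℂ (Lp ℂ 2 μ), FiniteDimensional ℂ W →
      (∀ h, ∀ v ∈ W, (leftRegularRep μ).op h v ∈ W) →
      (Module.finrank ℂ W : ℝ) ≤ D → ∀ v ∈ W, ‖(leftRegularRep μ).op h v - v‖ ≤ 1 / 2 * ‖v‖)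
    (hmass : 4 / D < ((∫ x, f x ∂μ) * ∫ x, g x ∂μ) ^ 2) :
    ∃ a b a' b', f a ≠ 0 ∧ g b ≠ 0 ∧ f a' ≠ 0 ∧ g b' ≠ 0 ∧ a * b = h * (a' * b') := by
  have hsupp : ∀ x, continuousConvolution μ f g x ≠ 0 → ∃ a b, f a ≠ 0 ∧ g b ≠ 0 ∧ a * b = x := by
    intro x hx
    rw [continuousConvolution_apply] at hx
    obtain ⟨y, hy⟩ : ∃ y, f y * g (y⁻¹ * x) ≠ 0 := by
      by_contra! hzero
      exact hx (by simp [hzero])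
    exact ⟨y, y⁻¹ * x, left_ne_zero_of_mul hy, right_ne_zero_of_mul hy, by group⟩
  set F := continuousConvolution μ f g with hF
  suffices ∃ x, F x ≠ 0 ∧ F (h⁻¹ * x) ≠ 0 by
    obtain ⟨x, hx, hx'⟩ := this
    obtain ⟨a, b, ha, hb, hab⟩ := hsupp x hx
    obtain ⟨a', b', ha', hb', hab'⟩ := hsupp _ hx'
    exact ⟨a, b, a', b', ha, hb, ha', hb', by rw [hab, hab']; group⟩
  by_contra! hdisj
  set S := convolutionOp μ g
  set φ := realToL2 μ f
  set π := leftRegularRep μ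
  have hSφ : S φ = realToL2 μ F := convolutionOp_realToL2 μ f g
  have hmain := π.norm_map_op_sub_sq_le S
    ((isCompactOperator_coefficientMap (convolutionKernel μ g)).clm_comp
      (BoundedContinuousFunction.toLp 2 μ ℂ))
    (inner_convolutionOp_op_op μ g) (K := 1)
    (fun n e he => sum_norm_sq_toLp_coefficientMap_le μ _
      (fun x => by
      rw [convolutionKernel_apply]; exact norm_realToL2_sq_le_one μ fun y => hg _) he) hD h hsmall φ
  have horth : inner ℂ (S (π.op h φ)) (S φ) = 0 := by
    simp only [S, convolutionOp, ContinuousLinearMap.comp_apply,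
      BoundedContinuousFunction.inner_toLp, π, coefficientMap_leftRegularRep_op, φ,
      coefficientMap_convolutionKernel, ← continuousConvolution_apply, ← hF]
    refine integral_eq_zero_of_ae (.of_forall fun x => ?_)
    by_cases hx : F x = 0
    · simp [hx]
    · simp [hdisj x hx]
  have hnormh : ‖S (π.op h φ)‖ ^ 2 = ‖S φ‖ ^ 2 := by
    rw [← inner_self_eq_norm_sq (𝕜 := ℂ), ← inner_self_eq_norm_sq (𝕜 := ℂ),
      inner_convolutionOp_op_op]
  have hpyth : ‖S (π.op h φ - φ)‖ ^ 2 = 2 * ‖S φ‖ ^ 2 := by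
    rw [map_sub, @norm_sub_sq ℂ, horth, hnormh]
    simp only [map_zero]
    ring
  have hφ : ‖φ‖ ^ 2 ≤ 1 := norm_realToL2_sq_le_one μ hf
  -- Cauchy–Schwarz against the constant function `1`.
  have hCS : ((∫ x, f x ∂μ) * ∫ x, g x ∂μ) ^ 2 ≤ ‖S φ‖ ^ 2 := by
    have h1 := norm_inner_le_norm (𝕜 := ℂ) (realToL2 μ (1 : C(G, ℝ))) (realToL2 μ F)
    have h2 : ‖realToL2 μ (1 : C(G, ℝ))‖ ^ 2 ≤ 1 := norm_realToL2_sq_le_one μ (by simp)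
    rw [inner_realToL2] at h1
    simp only [ContinuousMap.one_apply, one_mul, Complex.norm_real, hF,
      integral_continuousConvolution] at h1
    rw [hSφ, ← sq_abs, ← Real.norm_eq_abs]
    calc _ ≤ (‖realToL2 μ (1 : C(G, ℝ))‖ * ‖realToL2 μ F‖) ^ 2 := by gcongr
      _ = ‖realToL2 μ (1 : C(G, ℝ))‖ ^ 2 * ‖realToL2 μ F‖ ^ 2 := mul_pow _ _ _
      _ ≤ ‖realToL2 μ F‖ ^ 2 := mul_le_of_le_one_left (by positivity) h2
  have hD4 : 4 * 1 / D * ‖φ‖ ^ 2 ≤ 4 / D := by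
    rw [mul_one]; exact mul_le_of_le_one_right (by positivity) hφ
  have : 0 < 4 / D := by positivity
  rw [hpyth] at hmain
  nlinarith

end Convolution

/-! ### Covering numbers and measure -/

section Covering

variable {X : Type*} [MetricSpace X]

lemma coverNumber_le_card {A : Set X} {η : ℝ} {F : Finset X} (hFA : (F : Set X) ⊆ A)
    (hAF : A ⊆ ⋃ x ∈ F, ball x η) : coverNumber A η ≤ F.card :=
  Nat.sInf_le ⟨F, hFA, hAF, rfl⟩

lemma exists_cover_card_eq_coverNumber [CompactSpace X] (A : Set X) {η : ℝ} (hη : 0 < η) :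
    ∃ F : Finset X, (F : Set X) ⊆ A ∧ A ⊆ (⋃ x ∈ F, ball x η) ∧ F.card = coverNumber A η := by
  refine Nat.sInf_mem (s := {n | ∃ F : Finset X, (F : Set X) ⊆ A ∧ A ⊆ (⋃ x ∈ F, ball x η) ∧
    F.card = n}) ?_
  have htb : TotallyBounded A := isCompact_univ.totallyBounded.subset (Set.subset_univ A)
  obtain ⟨t, htA, ht, hcov⟩ := htb.exists_subset (dist_mem_uniformity hη)
  exact ⟨_, ht.toFinset, by simpa using htA, by simpa [ball] using hcov, rfl⟩

lemma coverNumber_pos [CompactSpace X] {A : Set X} (hA : A.Nonempty) {η : ℝ} (hη : 0 < η) :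
    0 < coverNumber A η := by
  obtain ⟨F, -, hcov, hF⟩ := exists_cover_card_eq_coverNumber A hη
  rw [← hF, Finset.card_pos]
  obtain ⟨a, ha⟩ := hA
  obtain ⟨x, hx, -⟩ := Set.mem_iUnion₂.1 (hcov ha)
  exact ⟨x, hx⟩

variable [MeasurableSpace X] (μ : Measure X) [IsProbabilityMeasure μ]

lemma one_le_coverNumber_univ_mul [CompactSpace X] {η : ℝ} (hη : 0 < η) {c : ℝ}
    (hc : ∀ x, μ.real (ball x η) ≤ c) : 1 ≤ coverNumber (Set.univ : Set X) η * c := by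
  obtain ⟨F, -, hcov, hF⟩ := exists_cover_card_eq_coverNumber (Set.univ : Set X) hη
  calc (1 : ℝ) = μ.real Set.univ := by simp
    _ ≤ μ.real (⋃ x ∈ F, ball x η) := measureReal_mono hcov (measure_ne_top _ _)
    _ ≤ ∑ x ∈ F, μ.real (ball x η) := measureReal_biUnion_finset_le _ _
    _ ≤ ∑ x ∈ F, c := Finset.sum_le_sum fun x _ => hc x
    _ = coverNumber (Set.univ : Set X) η * c := by rw [Finset.sum_const, hF, nsmul_eq_mul]

variable [BorelSpace X]

/-- A maximal `η`-separated subset of `A` is the set of centres of a cover of `A`, and the balls of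
radius `η / 2` around its points are disjoint. -/
lemma coverNumber_mul_le_measureReal_thickening {A : Set X} {η : ℝ} {c : ℝ}
    (hc0 : 0 < c) (hc : ∀ x, c ≤ μ.real (ball x (η / 2))) :
    coverNumber A η * c ≤ μ.real (thickening (η / 2) A) := by
  let P : Finset X → Prop := fun F =>
    (F : Set X) ⊆ A ∧ (F : Set X).Pairwise fun x y => η ≤ dist x y
  have hP : ∀ F, P F → F.card * c ≤ μ.real (thickening (η / 2) A) := by
    rintro F ⟨hFA, hsep⟩
    calc F.card * c = ∑ x ∈ F, c := by rw [Finset.sum_const, nsmul_eq_mul]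
      _ ≤ ∑ x ∈ F, μ.real (ball x (η / 2)) := Finset.sum_le_sum fun x _ => hc x
      _ = μ.real (⋃ x ∈ F, ball x (η / 2)) :=
        (measureReal_biUnion_finset (fun x hx y hy hxy => ball_disjoint_ball
          (by linarith [hsep hx hy hxy])) fun x _ => measurableSet_ball).symm
      _ ≤ μ.real (thickening (η / 2) A) := measureReal_mono
        (Set.iUnion₂_subset fun x hx => ball_subset_thickening (hFA hx) _)
  let s : Set ℕ := {n | ∃ F, P F ∧ F.card = n}
  have hbdd : BddAbove s := by
    refine ⟨⌈1 / c⌉₊, ?_⟩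
    rintro _ ⟨F, hF, rfl⟩
    have : (F.card : ℝ) ≤ 1 / c := (le_div_iff₀ hc0).2 ((hP F hF).trans measureReal_le_one)
    exact_mod_cast this.trans (Nat.le_ceil _)
  obtain ⟨F, hF, hcard⟩ : sSup s ∈ s := Nat.sSup_mem ⟨0, ∅, by simp [P], rfl⟩ hbdd
  refine le_trans ?_ (hP F hF)
  gcongr
  refine coverNumber_le_card hF.1 fun a ha => ?_
  by_contra hcov
  simp only [Set.mem_iUnion, mem_ball, not_exists, not_lt] at hcov
  -- If `a ∈ F`, then `η ≤ 0` and all the balls are empty, against `0 < c`.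
  by_cases haF : a ∈ F
  · have h1 := hcov a haF
    rw [dist_self] at h1
    have h2 := hc a
    rw [ball_eq_empty.2 (by linarith)] at h2
    simp at h2
    linarith
  · classical
    have hins : P (insert a F) := by
      refine ⟨by simpa [Set.insert_subset_iff] using ⟨ha, hF.1⟩, ?_⟩
      rw [Finset.coe_insert]
      refine hF.2.insert fun x hx _ => ⟨hcov x hx, ?_⟩
      rw [dist_comm]; exact hcov x hx
    have := le_csSup hbdd (show (insert a F).card ∈ s from ⟨_, hins, rfl⟩)
    rw [Finset.card_insert_of_notMem haF] at this
    omega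

end Covering

/-! ### Tent functions -/

section Bump

variable {X : Type*} [MetricSpace X]

/-- The tent function of height `1` over the `η`-neighbourhood of `A`. -/
noncomputable def tentFunction (A : Set X) (η : ℝ) : C(X, ℝ) :=
  ⟨fun x => max 0 (1 - infDist x A / η), by fun_prop⟩

lemma tentFunction_mem_Icc (A : Set X) {η : ℝ} (hη : 0 < η) (x : X) :
    tentFunction A η x ∈ Set.Icc (0 : ℝ) 1 :=
  ⟨le_max_left _ _, max_le zero_le_one (sub_le_self _ (div_nonneg infDist_nonneg hη.le))⟩

lemma mem_thickening_of_tentFunction_ne_zero {A : Set X} (hA : A.Nonempty) {η : ℝ} (hη : 0 < η)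
    {x : X} (hx : tentFunction A η x ≠ 0) : x ∈ thickening η A := by
  rw [mem_thickening_iff, ← infDist_lt_iff hA]
  by_contra! h
  exact hx (max_eq_left (sub_nonpos.2 ((one_le_div hη).2 h)))

lemma half_measureReal_thickening_le_integral [CompactSpace X] [MeasurableSpace X] [BorelSpace X]
    (μ : Measure X) [IsProbabilityMeasure μ] {A : Set X} (hA : A.Nonempty) {η : ℝ} (hη : 0 < η) :
    1 / 2 * μ.real (thickening (η / 2) A) ≤ ∫ x, tentFunction A η x ∂μ := by
  have hint : Integrable (tentFunction A η) μ :=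
    (tentFunction A η).continuous.integrable_of_hasCompactSupport (.of_compactSpace _)
  have hmeas : MeasurableSet (thickening (η / 2) A) := isOpen_thickening.measurableSet
  calc 1 / 2 * μ.real (thickening (η / 2) A)
      = ∫ x, (thickening (η / 2) A).indicator (fun _ => (1 / 2 : ℝ)) x ∂μ := by
        rw [integral_indicator_const _ hmeas, smul_eq_mul, mul_comm]
    _ ≤ _ := integral_mono ((integrable_const _).indicator hmeas) hint fun x => by
        refine Set.indicator_le' (fun x hx => ?_) (fun x _ => (tentFunction_mem_Icc A hη x).1) x
        rw [mem_thickening_iff, ← infDist_lt_iff hA] at hx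
        refine le_max_of_le_right ?_
        have : infDist x A / η ≤ 1 / 2 := by rw [div_le_iff₀ hη]; linarith
        linarith

end Bump

/-! ### The product theorem -/

lemma measureReal_ball_eq_ball_one {G : Type*} [Group G] [MetricSpace G] [IsIsometricSMul G G]
    [MeasurableSpace G] (μ : Measure G) [MeasurableConstSMul G G] [SMulInvariantMeasure G G μ]
    (x : G) (r : ℝ) :
    μ.real (ball x r) = μ.real (ball 1 r) := by
  rw [measureReal_def, measureReal_def, ← measure_smul μ x (ball 1 r), Metric.smul_ball, smul_eq_mul,
    mul_one]

theorem theorem3 (L C₀ C₁ d₀ : ℝ) (hL : 1 ≤ L) (hC₀ : 1 ≤ C₀) (hC₁ : 1 ≤ C₁) (hd₀ : 0 < d₀) :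
    ∃ c : ℝ, 0 < c ∧ ∀ ε : ℝ, 0 < ε → ∃ δ : ℝ, 0 < δ ∧
      ∀ (G : Type u) [Group G] [MetricSpace G] [IsTopologicalGroup G] [CompactSpace G]
        [IsIsometricSMul G G] [IsIsometricSMul Gᵐᵒᵖ G] [MeasurableSpace G] [BorelSpace G]
        (μ : Measure G) [μ.IsHaarMeasure] [IsProbabilityMeasure μ],
        IsLocallyRandom G L C₀ → DimensionCondition μ C₁ d₀ →
        ∀ (η : ℝ) (A B : Set G), 0 < η → A.Nonempty → B.Nonempty →
          (1 - δ) * metricEntropy (Set.univ : Set G) η ≤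
            (metricEntropy A η + metricEntropy B η) / 2 →
          η ^ ε ≤ c →
          ball (1 : G) (η ^ ε) ⊆
            thickening η A * thickening η B * (thickening η B)⁻¹ * (thickening η A)⁻¹ := by
  have hL0 : 0 < L := by linarith
  have hlogC₀ : 0 ≤ Real.log (2 * C₀) := Real.log_nonneg (by linarith)
  have hlogC₁ : 0 ≤ Real.log C₁ := Real.log_nonneg hC₁
  have hlog2 : 0 < Real.log 2 := Real.log_pos one_lt_two
  have hlog4 : 0 < Real.log 4 := Real.log_pos (by norm_num)
  set M : ℝ := 3 * Real.log 4 + Real.log (2 * C₀) + 8 * Real.log C₁ + 4 * d₀ * Real.log 2 with hM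
  have hM0 : 0 ≤ M := by positivity
  -- `M` collects the constants in the requirement `4 / D < m ^ 2` below, in logarithmic form; `δ` is
  -- chosen so that the powers of `η` lost on the right are at most half of those gained on the left.
  refine ⟨Real.exp (-(2 * L * (M + 1))), Real.exp_pos _, fun ε hε => ?_⟩
  refine ⟨min 1 (ε / (8 * d₀ * L)), by positivity, ?_⟩
  intro G _ _ _ _ _ _ _ _ μ _ _ hG hDC η A B hη hA hB hent hηc h hh
  set δ := min 1 (ε / (8 * d₀ * L)) with hδ
  have hδ1 : δ ≤ 1 := min_le_left _ _
  have hδ0 : 0 < δ := by positivity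
  have hδε : 4 * (δ * d₀) ≤ ε / (2 * L) := by
    calc 4 * (δ * d₀) ≤ 4 * (ε / (8 * d₀ * L) * d₀) := by gcongr; exact min_le_right _ _
      _ = ε / (2 * L) := by field_simp; norm_num
  have hlogη : ε * Real.log η ≤ -(2 * L * (M + 1)) := by
    have := Real.log_le_log (Real.rpow_pos_of_pos hη ε) hηc
    rwa [Real.log_rpow hη, Real.log_exp] at this
  have hlogη' : ε / (2 * L) * Real.log η ≤ -(M + 1) := by
    rw [div_mul_eq_mul_div, div_le_iff₀ (by positivity)]
    linarith
  have hlogη0 : Real.log η < 0 := by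
    by_contra! hneg
    have : 0 ≤ ε / (2 * L) * Real.log η := by positivity
    linarith
  have hη1 : η < 1 := (Real.log_neg_iff hη).1 hlogη0
  -- Size of the neighbourhoods of `A` and `B`.
  have hlow := (hDC (η / 2) (by positivity) (by linarith)).1
  have hupp := (hDC η hη hη1).2
  set b := 1 / C₁ * (η / 2) ^ d₀ with hb
  have hb0 : 0 < b := by positivity
  have hlogb : Real.log b = -Real.log C₁ + d₀ * (Real.log η - Real.log 2) := by
    rw [hb, Real.log_mul (by positivity) (by positivity), Real.log_rpow (by positivity),
      Real.log_div hη.ne' two_ne_zero, one_div, Real.log_inv]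
  have hthick : ∀ E : Set G, E.Nonempty → 0 < (coverNumber E η : ℝ) ∧
      1 / 2 * (coverNumber E η * b) ≤ ∫ x, tentFunction E η x ∂μ := fun E hE =>
    ⟨by exact_mod_cast coverNumber_pos hE hη,
      (mul_le_mul_of_nonneg_left (coverNumber_mul_le_measureReal_thickening μ hb0 fun x =>
        hlow.trans (measureReal_ball_eq_ball_one μ x _).ge) (by norm_num)).trans
        (half_measureReal_thickening_le_integral μ hE hη)⟩
  obtain ⟨hA0, hAb⟩ := hthick A hA
  obtain ⟨hB0, hBb⟩ := hthick B hB
  have hNG : -Real.log C₁ - d₀ * Real.log η ≤ metricEntropy (Set.univ : Set G) η := by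
    have h1 := one_le_coverNumber_univ_mul μ hη fun x =>
      (measureReal_ball_eq_ball_one μ x η).le.trans hupp
    have h2 := Real.log_nonneg h1
    have h3 : (0 : ℝ) < coverNumber (Set.univ : Set G) η := by
      exact_mod_cast coverNumber_pos Set.univ_nonempty hη
    rw [Real.log_mul h3.ne' (by positivity), Real.log_mul (by positivity) (by positivity),
      Real.log_rpow hη] at h2
    rw [metricEntropy]
    linarith
  set m := (∫ x, tentFunction A η x ∂μ) * ∫ x, tentFunction B η x ∂μ with hm
  have hmlow : 1 / 2 * (coverNumber A η * b) * (1 / 2 * (coverNumber B η * b)) ≤ m :=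
    mul_le_mul hAb hBb (by positivity) (le_trans (by positivity) hAb)
  have hm0 : 0 < m := lt_of_lt_of_le (by positivity) hmlow
  have hlogm : -Real.log 4 - 4 * Real.log C₁ - 2 * d₀ * Real.log 2 + 2 * (δ * d₀) * Real.log η ≤
      Real.log m := by
    refine le_trans ?_ (Real.log_le_log (by positivity) hmlow)
    have e : 1 / 2 * (coverNumber A η * b) * (1 / 2 * (coverNumber B η * b)) =
      4⁻¹ * (coverNumber A η * coverNumber B η * (b * b)) := by ring
    rw [e, Real.log_mul (by positivity) (by positivity), Real.log_mul (by positivity)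
      (by positivity), Real.log_mul (by positivity) (by positivity), Real.log_mul (by positivity)
      (by positivity), Real.log_inv, hlogb]
    have h1 := mul_le_mul_of_nonneg_left hNG (sub_nonneg.2 hδ1)
    have h2 : 0 ≤ δ * Real.log C₁ := by positivity
    unfold metricEntropy at hent h1
    linarith
  -- `D` solves `C₀ * D ^ L * η ^ ε = 1 / 2`: up to this dimension `h` moves vectors by at most half
  -- their length.
  have ht : 0 < η ^ ε := by positivity
  set D := (2 * C₀ * η ^ ε) ^ (-L⁻¹) with hD
  have hD0 : 0 < D := by positivity
  have hDL : D ^ L = (2 * C₀ * η ^ ε)⁻¹ := by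
    rw [hD, ← Real.rpow_mul (by positivity), neg_mul, inv_mul_cancel₀ hL0.ne', Real.rpow_neg_one]
  have hmass : 4 / D < m ^ 2 := by
    rw [← Real.log_lt_log_iff (by positivity) (by positivity), Real.log_div (by norm_num) hD0.ne',
      hD, Real.log_rpow (by positivity), Real.log_mul (by positivity) ht.ne', Real.log_rpow hη,
      Real.log_pow]
    have h1 : L⁻¹ * Real.log (2 * C₀) ≤ Real.log (2 * C₀) :=
      mul_le_of_le_one_left hlogC₀ (inv_le_one_of_one_le₀ hL)
    have h2 : L⁻¹ * (ε * Real.log η) = 2 * (ε / (2 * L) * Real.log η) := by field_simp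
    have h3 := mul_le_mul_of_nonpos_right hδε hlogη0.le
    push_cast
    linarith
  obtain ⟨x, y, x', y', hx, hy, hx', hy', hxy⟩ := exists_mul_mul_eq_mul_of_ne_zero μ
    (tentFunction_mem_Icc A hη) (tentFunction_mem_Icc B hη) hD0 h (fun W _ hW hdim v hv => by
      have h1 := hG.norm_op_sub_op_le hL0.le (by linarith) h 1 ((leftRegularRep μ).restrict W hW)
        ⟨v, hv⟩
      rw [UnitaryRep.op_one, one_apply_eq_self] at h1
      refine h1.trans (mul_le_mul_of_nonneg_right ?_ (norm_nonneg v))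
      calc C₀ * (Module.finrank ℂ W : ℝ) ^ L * dist h 1 ≤ C₀ * D ^ L * η ^ ε := by
            gcongr; exact (mem_ball.1 hh).le
        _ = 1 / 2 := by rw [hDL]; field_simp) hmass
  have hmemA := fun z => mem_thickening_of_tentFunction_ne_zero (x := z) hA hη
  have hmemB := fun z => mem_thickening_of_tentFunction_ne_zero (x := z) hB hη
  have hhe : h = x * y * y'⁻¹ * x'⁻¹ := by rw [hxy]; group
  rw [hhe]
  exact Set.mul_mem_mul (Set.mul_mem_mul (Set.mul_mem_mul (hmemA _ hx) (hmemB _ hy))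
    (Set.inv_mem_inv.2 (hmemB _ hy'))) (Set.inv_mem_inv.2 (hmemA _ hx'))
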